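/- Throughout, a standard probability space (Lebesgue–Rokhlin space, possibly with atoms) is a standard Borel space $X$ with a probability measure $\mu$, and $T$ is an ergodic automorphism of $(X,\mu)$: an invertible, bimeasurable, $\mu$-preserving, ergodic transformation. A semimetric on $X$ is a function $\rho:X\times X\to[0,\infty)$ with $\rho(x,x)=0$, $\rho(x,y)=\rho(y,x)$ and $\rho(x,z)\le\rho(x,y)+\rho(y,z)$. It is measurable if it is measurable on $(X^2,\mu^2)$ (with respect to the completed product measure), admissible if it is measurable and there is a set $X_1\subset X$ of full measure on which $\rho$ is separable, and summable if $\int_{X^2}\rho\,d\mu^2<\infty$. For $k\in\mathbb Z$ put $T^k\rho(x,y)=\rho(T^kx,T^ky)$, and for $n\ge1$ put $T^n_{av}\rho=\frac1n\sum_{k=0}^{n-1}T^k\rho$. The semimetric $\rho$ is generating if there is a measurable set $X'\subset X$ of full measure such that for any two distinct $x,y\in X'$ there is $k\in\mathbb Z$ with $T^k\rho(x,y)>0$. For $\varepsilon>0$ the $\varepsilon$-entropy is $\mathbb H_\varepsilon(X,\mu,\rho)=\log_2k$, where $k\ge1$ is the least integer for which $X$ is a disjoint union of (possibly empty) measurable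 sets $X_0,X_1,\dots,X_k$ such that $\mu(X_0)<\varepsilon$ and each of $X_1,\dots,X_k$ has $\rho$-diameter less than $\varepsilon$; if there is no such $k$, then $\mathbb H_\varepsilon(X,\mu,\rho)=+\infty$. A sequence $h=\{h_n\}_{n\ge1}$ of positive numbers is a scaling entropy sequence of $(X,\mu,T)$ if there is a summable admissible generating semimetric $\rho$ on $(X,\mu)$ such that $$\limsup_{n\to\infty}\frac{\mathbb H_\varepsilon(X,\mu,T^n_{av}\rho)}{h_n}<+\infty\quad\text{for every }\varepsilon>0,\qquad \liminf_{n\to\infty}\frac{\mathbb H_\varepsilon(X,\mu,T^n_{av}\rho)}{h_n}>0\quad\text{for all sufficiently small }\varepsilon>0.$$ **Corollary (monotonicity under factors).** Let $T_1$, $T_2$ be ergodic automorphisms of standard probability spaces $(X_1,\mu_1)$, $(X_2,\mu_2)$, and suppose that $(X_2,\mu_2,T_2)$ is a factor of $(X_1,\mu_1,T_1)$, that is, there is a measurable map $\pi:X_1\to X_2$ with $\pi_*\mu_1=\mu_2$ and $\pi\circ T_1=T_2\circ\pi$ $\mu_1$-almost everywhere. If $h^1=\{h^1_n\}$ and $h^2=\{h^2_n\}$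 are scaling entropy sequences of $(X_1,\mu_1,T_1)$ and $(X_2,\mu_2,T_2)$ respectively, then $h^2_n=O(h^1_n)$ as $n\to\infty$. -/

import Mathlib

open MeasureTheory Filter

open scoped ENNReal

namespace ScalingEntropy

/-- A (finite, everywhere defined) semimetric on `X`. Nonnegativity follows from the axioms. -/
structure IsSemimetric {X : Type*} (ρ : X → X → ℝ) : Prop where
  self_eq_zero : ∀ x, ρ x x = 0
  symm : ∀ x y, ρ x y = ρ y x
  triangle : ∀ x y z, ρ x z ≤ ρ x y + ρ y z

/-- A semimetric that is measurable on `(X², μ²)`. `AEMeasurable` is measurability with respect to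
the completion of the product measure, as is usual on Lebesgue–Rokhlin spaces. -/
structure IsMeasurableSemimetric {X : Type*} [MeasurableSpace X] (μ : Measure X)
    (ρ : X → X → ℝ) : Prop where
  isSemimetric : IsSemimetric ρ
  aemeasurable : AEMeasurable (fun p : X × X => ρ p.1 p.2) (μ.prod μ)

/-- The subset `Y`, with the restriction of `ρ`, is separable. -/
def IsSeparableOn {X : Type*} (ρ : X → X → ℝ) (Y : Set X) : Prop :=
  ∃ D : Set X, D ⊆ Y ∧ D.Countable ∧ ∀ x ∈ Y, ∀ δ : ℝ, 0 < δ → ∃ d ∈ D, ρ x d < δ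

/-- A measurable semimetric that is separable on some subset of full measure. -/
structure IsAdmissible {X : Type*} [MeasurableSpace X] (μ : Measure X)
    (ρ : X → X → ℝ) : Prop where
  isMeasurableSemimetric : IsMeasurableSemimetric μ ρ
  separable : ∃ X₁ : Set X, μ X₁ᶜ = 0 ∧ IsSeparableOn ρ X₁

/-- Summability: `ρ` has finite integral over `(X², μ²)`. -/
def IsSummable {X : Type*} [MeasurableSpace X] (μ : Measure X) (ρ : X → X → ℝ) : Prop :=
  Integrable (fun p : X × X => ρ p.1 p.2) (μ.prod μ)

/-- The diameter of a set in a semimetric, with values in `[0, ∞]`. -/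
noncomputable def diameter {X : Type*} (ρ : X → X → ℝ) (A : Set X) : ℝ≥0∞ :=
  ⨆ x ∈ A, ⨆ y ∈ A, ENNReal.ofReal (ρ x y)

/-- `X` is partitioned into disjoint measurable sets `A 0, A 1, …, A k` such that `A 0` has measure
less than `ε` and the other ones have `ρ`-diameter less than `ε`. -/
def HasPartition {X : Type*} [MeasurableSpace X] (μ : Measure X) (ρ : X → X → ℝ) (ε : ℝ)
    (k : ℕ) : Prop :=
  ∃ A : Fin (k + 1) → Set X,
    (∀ j, MeasurableSet (A j)) ∧ Pairwise (fun i j => Disjoint (A i) (A j)) ∧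
    (⋃ j, A j) = Set.univ ∧ μ (A 0) < ENNReal.ofReal ε ∧
    ∀ j, j ≠ 0 → diameter ρ (A j) < ENNReal.ofReal ε

open Classical in
/-- The `ε`-entropy: `log₂` of the least positive `k` for which a partition as in `HasPartition`
exists, and `+∞` if there is no such `k`. -/
noncomputable def epsEntropy {X : Type*} [MeasurableSpace X] (μ : Measure X) (ρ : X → X → ℝ)
    (ε : ℝ) : ℝ≥0∞ :=
  if {k : ℕ | 1 ≤ k ∧ HasPartition μ ρ ε k}.Nonempty then
    ENNReal.ofReal (Real.logb 2 (sInf {k : ℕ | 1 ≤ k ∧ HasPartition μ ρ ε k} : ℕ))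
  else ⊤

/-- The shift `T^k ρ (x, y) = ρ (T^k x, T^k y)`, for an integer `k`. -/
def shift {X : Type*} [MeasurableSpace X] (T : X ≃ᵐ X) (k : ℤ) (ρ : X → X → ℝ) : X → X → ℝ :=
  fun x y => ρ (((T.toEquiv : Equiv.Perm X) ^ k) x) (((T.toEquiv : Equiv.Perm X) ^ k) y)

/-- The average `n⁻¹ ∑_{k < n} T^k ρ` (used for `n ≥ 1`). -/
noncomputable def average {X : Type*} [MeasurableSpace X] (T : X ≃ᵐ X) (n : ℕ)
    (ρ : X → X → ℝ) : X → X → ℝ :=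
  fun x y => (1 / (n : ℝ)) * ∑ k ∈ Finset.range n, shift T (k : ℤ) ρ x y

/-- The two-sided shifts of `ρ` separate points mod zero. -/
def IsGenerating {X : Type*} [MeasurableSpace X] (μ : Measure X) (T : X ≃ᵐ X)
    (ρ : X → X → ℝ) : Prop :=
  ∃ X' : Set X, MeasurableSet X' ∧ μ X'ᶜ = 0 ∧
    ∀ x ∈ X', ∀ y ∈ X', x ≠ y → ∃ k : ℤ, 0 < shift T k ρ x y

/-- `h` (a sequence indexed by `n ≥ 1`; the value `h 0` plays no role) is a scaling sequence for
the semimetric `ρ`. -/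
structure IsScalingSequence {X : Type*} [MeasurableSpace X] (μ : Measure X) (T : X ≃ᵐ X)
    (ρ : X → X → ℝ) (h : ℕ → ℝ) : Prop where
  pos : ∀ n, 1 ≤ n → 0 < h n
  upper : ∀ ε : ℝ, 0 < ε →
    limsup (fun n => epsEntropy μ (average T n ρ) ε / ENNReal.ofReal (h n)) atTop < ⊤
  lower : ∃ ε₀ : ℝ, 0 < ε₀ ∧ ∀ ε : ℝ, 0 < ε → ε < ε₀ →
    0 < liminf (fun n => epsEntropy μ (average T n ρ) ε / ENNReal.ofReal (h n)) atTop

/-- `h` is a scaling entropy sequence of the system `(X, μ, T)`: it is a scaling sequence for some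
summable admissible generating semimetric. -/
def IsScalingEntropySequence {X : Type*} [MeasurableSpace X] (μ : Measure X) (T : X ≃ᵐ X)
    (h : ℕ → ℝ) : Prop :=
  ∃ ρ : X → X → ℝ, IsAdmissible μ ρ ∧ IsSummable μ ρ ∧ IsGenerating μ T ρ ∧
    IsScalingSequence μ T ρ h

/-- `(X₂, μ₂, T₂)` is a factor of `(X₁, μ₁, T₁)`. -/
def IsFactor {X₁ X₂ : Type*} [MeasurableSpace X₁] [MeasurableSpace X₂]
    (μ₂ : Measure X₂) (T₂ : X₂ ≃ᵐ X₂) (μ₁ : Measure X₁) (T₁ : X₁ ≃ᵐ X₁) : Prop :=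
  ∃ π : X₁ → X₂, MeasurePreserving π μ₁ μ₂ ∧ ∀ᵐ x ∂μ₁, π (T₁ x) = T₂ (π x)

end ScalingEntropy

namespace ScalingEntropy

/-! Lift `ρ₂` to `X₁` through `π`. Since `ρ₁` is generating, the distances from shifted points to a
dense sequence separate almost all points of `X₁`. Compactness then bounds `ρ₂ (π x) (π y)` by a
multiple of finitely many shifts of `ρ₁` plus an error `f x + f y` with `f` small in `L¹`
(`exists_le_sum_abs_sub_add`, `exists_le_sum_shift_add`).

This bound survives averaging. A fixed shift changes the window `[0, n)` at boundedly many places,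
so its boundary cost vanishes as `n` grows, while invariance of the measure keeps the averaged error
small in `L¹`. By Markov's inequality, points close in the average of `ρ₁` have images close in the
average of `ρ₂`, outside a small set and with `δ` independent of `n` (`exists_average_le`).

Hence a `δ`-partition upstairs yields an `ε`-partition downstairs with the same number of pieces
(`HasPartition.of_factor`). The entropies are thus comparable for large `n`, and so are the scaling
sequences. -/

theorem IsSemimetric.nonneg {X : Type*} {ρ : X → X → ℝ} (hρ : IsSemimetric ρ) (x y : X) :
    0 ≤ ρ x y := by
  have h := hρ.triangle x y x
  rw [hρ.self_eq_zero, hρ.symm y x] at h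
  linarith

/-! ### Dense sequences and finite separation up to small error -/

/-- A summable admissible semimetric has a sequence of points which is dense almost everywhere and
such that the distances to these points are integrable. -/
theorem IsAdmissible.exists_integrable_dense_seq {X : Type*} [MeasurableSpace X] {μ : Measure X}
    [IsProbabilityMeasure μ] {ρ : X → X → ℝ} (hρ : IsAdmissible μ ρ) (hs : IsSummable μ ρ) :
    ∃ e : ℕ → X, (∀ j, Integrable (fun x => ρ x (e j)) μ) ∧
      ∀ᵐ x ∂μ, ∀ δ : ℝ, 0 < δ → ∃ j, ρ x (e j) < δ := by
  obtain ⟨X₁, hX₁, D, hDX, hDc, hD⟩ := hρ.separable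
  have hsm := hρ.isMeasurableSemimetric.isSemimetric
  have hint : ∀ᵐ x ∂μ, Integrable (fun y => ρ x y) μ := Integrable.prod_right_ae hs
  have hX₁' : ∀ᵐ x ∂μ, x ∈ X₁ := by rw [ae_iff]; exact hX₁
  have hY := hX₁'.and hint
  obtain ⟨y₀, hy₀⟩ := hY.exists
  obtain ⟨d₀, hd₀, -⟩ := hD y₀ hy₀.1 1 one_pos
  have : Countable D := hDc
  have : Nonempty D := ⟨⟨d₀, hd₀⟩⟩
  -- Points of `D` may have non-integrable distance functions, so each `d` is replaced, at every
  -- scale, by a nearby point with an integrable one; `y₀` is a dummy when there is none.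
  have hq : ∀ p : D × ℕ, ∃ y, Integrable (fun x => ρ x y) μ ∧
      ((∃ z, (z ∈ X₁ ∧ Integrable (fun x => ρ z x) μ) ∧ ρ z p.1 < 1 / ((p.2 : ℝ) + 1)) →
        ρ y p.1 < 1 / ((p.2 : ℝ) + 1)) := by
    intro p
    by_cases h : ∃ z, (z ∈ X₁ ∧ Integrable (fun x => ρ z x) μ) ∧ ρ z p.1 < 1 / ((p.2 : ℝ) + 1)
    · obtain ⟨z, hz, hz'⟩ := h
      exact ⟨z, by simpa only [hsm.symm z] using hz.2, fun _ => hz'⟩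
    · exact ⟨y₀, by simpa only [hsm.symm y₀] using hy₀.2, fun h' => absurd h' h⟩
  choose q hq₁ hq₂ using hq
  obtain ⟨g, hg⟩ := exists_surjective_nat (D × ℕ)
  refine ⟨fun j => q (g j), fun j => hq₁ _, ?_⟩
  filter_upwards [hY] with x hx δ hδ
  obtain ⟨n, hn⟩ := exists_nat_one_div_lt (half_pos hδ)
  obtain ⟨d, hd, hxd⟩ := hD x hx.1 (1 / ((n : ℝ) + 1)) Nat.one_div_pos_of_nat
  obtain ⟨j, hj⟩ := hg (⟨d, hd⟩, n)
  refine ⟨j, ?_⟩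
  have h₁ := hq₂ (⟨d, hd⟩, n) ⟨x, hx, hxd⟩
  have h₂ := hsm.triangle x d (q (g j))
  rw [hj, hsm.symm d] at h₂
  rw [hj]
  simp only at h₁ hxd
  linarith

/-- If countably many functions separate points, then, up to a set of small measure, finitely many
of them separate uniformly the pieces of a given countable partition. -/
theorem exists_finset_separating {X ι : Type*} [MeasurableSpace X] [StandardBorelSpace X]
    [Countable ι] {μ : Measure X} [IsFiniteMeasure μ] {φ : ι → X → ℝ}
    (hφ : ∀ i, AEMeasurable (φ i) μ) {S : Set X} (hS : ∀ᵐ x ∂μ, x ∈ S)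
    (hsep : ∀ x ∈ S, ∀ y ∈ S, (∀ i, φ i x = φ i y) → x = y)
    {c : X → ℕ} (hc : Measurable c) {η : ℝ≥0∞} (hη : η ≠ 0) :
    ∃ B : Set X, MeasurableSet B ∧ μ B < η ∧ ∃ (I : Finset ι) (r : ℝ), 0 < r ∧
      ∀ x ∉ B, ∀ y ∉ B, c x ≠ c y → r ≤ ∑ i ∈ I, |φ i x - φ i y| := by
  have hgood : ∀ᵐ x ∂μ, x ∈ S ∧ ∀ i, φ i x = (hφ i).mk (φ i) x :=
    hS.and (ae_all_iff.2 fun i => (hφ i).ae_eq_mk)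
  set N : Set X := toMeasurable μ {x | x ∈ S ∧ ∀ i, φ i x = (hφ i).mk (φ i) x}ᶜ with hN
  have hN0 : μ N = 0 := by rw [hN, measure_toMeasurable]; exact hgood
  have hNm : MeasurableSet N := measurableSet_toMeasurable _ _
  have hNc : ∀ x ∉ N, x ∈ S ∧ ∀ i, φ i x = (hφ i).mk (φ i) x := by
    intro x hx
    by_contra h
    exact hx (subset_toMeasurable _ _ h)
  -- Carrying the label `c` as a coordinate in discrete `ℕ` makes "different labels" a closed
  -- condition on the image.
  set Ψ : X → (ι → ℝ) × ℕ := fun x => (fun i => (hφ i).mk (φ i) x, c x) with hΨ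
  have hΨm : Measurable Ψ :=
    (measurable_pi_iff.2 fun i => (hφ i).measurable_mk).prodMk hc
  have hinj : ∀ x ∉ N, ∀ y ∉ N, (Ψ x).1 = (Ψ y).1 → x = y := by
    intro x hx y hy h
    refine hsep x (hNc x hx).1 y (hNc y hy).1 fun i => ?_
    rw [(hNc x hx).2, (hNc y hy).2]
    exact congrFun h i
  -- Lusin–Souslin: `Ψ` is injective off `N`. Inner regularity of the image measure then supplies
  -- the compact set `L`.
  have hEm : MeasurableSet (Ψ '' Nᶜ) :=
    hNm.compl.image_of_measurable_injOn hΨm fun x hx y hy h => hinj x hx y hy (congrArg Prod.fst h)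
  obtain ⟨L, hLE, hLc, hLμ⟩ := hEm.exists_isCompact_sdiff_lt (measure_ne_top (μ.map Ψ) _) hη
  have hLm : MeasurableSet L := hLc.measurableSet
  refine ⟨N ∪ (Ψ ⁻¹' L)ᶜ, hNm.union (hΨm hLm).compl, ?_, ?_⟩
  · rw [Measure.map_apply hΨm (hEm.diff hLm)] at hLμ
    refine lt_of_le_of_lt ?_ hLμ
    calc μ (N ∪ (Ψ ⁻¹' L)ᶜ) ≤ μ (N ∪ Ψ ⁻¹' (Ψ '' Nᶜ \ L)) := by
          refine measure_mono ?_
          rintro x (hx | hx)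
          · exact Or.inl hx
          · by_cases hxN : x ∈ N
            · exact Or.inl hxN
            · exact Or.inr ⟨⟨x, hxN, rfl⟩, hx⟩
      _ ≤ μ N + _ := measure_union_le _ _
      _ = _ := by rw [hN0, zero_add]
  · set P : Set (((ι → ℝ) × ℕ) × ((ι → ℝ) × ℕ)) := (L ×ˢ L) ∩ {p | p.1.2 ≠ p.2.2} with hP
    have hPc : IsCompact P := by
      refine (hLc.prod hLc).inter_right ?_
      exact (isClosed_discrete {q : ℕ × ℕ | q.1 ≠ q.2}).preimage
        (f := fun p : ((ι → ℝ) × ℕ) × ((ι → ℝ) × ℕ) => (p.1.2, p.2.2)) (by fun_prop)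
    -- Pairs in `P` come from distinct points, so some coordinate differs. Finitely many coordinates
    -- suffice by compactness, and `r` is a positive lower bound of the resulting continuous sum on
    -- `P`.
    obtain ⟨I, hI⟩ := hPc.elim_finite_subcover
      (fun i => {p : ((ι → ℝ) × ℕ) × ((ι → ℝ) × ℕ) | 0 < |p.1.1 i - p.2.1 i|})
      (fun i => isOpen_lt (by fun_prop) (by fun_prop)) (by
        rintro ⟨u, v⟩ ⟨⟨hu, hv⟩, huv⟩
        obtain ⟨x, hx, rfl⟩ := hLE hu
        obtain ⟨y, hy, rfl⟩ := hLE hv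
        by_contra h
        refine huv ?_
        have : x = y := by
          refine hinj x hx y hy (funext fun i => ?_)
          by_contra hne
          exact h (Set.mem_iUnion.2 ⟨i, abs_pos.2 (sub_ne_zero.2 hne)⟩)
        simp [this])
    obtain ⟨r, hr, hrP⟩ := hPc.exists_forall_le'
      (f := fun p : ((ι → ℝ) × ℕ) × ((ι → ℝ) × ℕ) => ∑ i ∈ I, |p.1.1 i - p.2.1 i|) (a := 0)
      (by fun_prop) (by
        intro p hp
        obtain ⟨i, hiI, hi⟩ := Set.mem_iUnion₂.1 (hI hp)
        exact Finset.sum_pos' (fun _ _ => abs_nonneg _) ⟨i, hiI, hi⟩)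
    refine ⟨I, r, hr, fun x hx y hy hxy => ?_⟩
    simp only [Set.mem_union, Set.mem_compl_iff, not_or, not_not] at hx hy
    have := hrP (Ψ x, Ψ y) ⟨⟨hx.2, hy.2⟩, hxy⟩
    refine this.trans_eq (Finset.sum_congr rfl fun i _ => ?_)
    rw [(hNc x hx.1).2, (hNc y hy.1).2]

/-- If `ψ j` are distance functions to a sequence of points which is dense almost everywhere and
`R i j` bounds the mutual distances of these points, then the distance is controlled, up to an error
which is small in `L¹`, by finitely many members of any countable separating family. -/
theorem exists_le_sum_abs_sub_add {X ι : Type*} [MeasurableSpace X] [StandardBorelSpace X]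
    [Countable ι] {μ : Measure X} [IsProbabilityMeasure μ] {φ : ι → X → ℝ}
    (hφ : ∀ i, AEMeasurable (φ i) μ) {S : Set X} (hS : ∀ᵐ x ∂μ, x ∈ S)
    (hsep : ∀ x ∈ S, ∀ y ∈ S, (∀ i, φ i x = φ i y) → x = y)
    {d : X → X → ℝ} {ψ : ℕ → X → ℝ} {R : ℕ → ℕ → ℝ}
    (hψ : ∀ j, AEMeasurable (ψ j) μ) (hψ₀ : Integrable (ψ 0) μ) (hψnn : ∀ j x, 0 ≤ ψ j x)
    (hψd : ∀ᵐ x ∂μ, ∀ δ : ℝ, 0 < δ → ∃ j, ψ j x < δ) (hR : ∀ j, R j j = 0)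
    (hd : ∀ x y i j, d x y ≤ ψ i x + R i j + ψ j y) {η : ℝ} (hη : 0 < η) :
    ∃ (I : Finset ι) (C : ℝ) (f : X → ℝ), 0 ≤ C ∧ Integrable f μ ∧ (∀ x, 0 ≤ f x) ∧
      ∫ x, f x ∂μ < η ∧
      ∃ Z : Set X, (∀ᵐ x ∂μ, x ∈ Z) ∧ ∀ x ∈ Z, ∀ y ∈ Z,
        d x y ≤ C * ∑ i ∈ I, |φ i x - φ i y| + (f x + f y) := by
  classical
  have hgood : ∀ᵐ x ∂μ, (∀ δ : ℝ, 0 < δ → ∃ j, ψ j x < δ) ∧ ∀ j, ψ j x = (hψ j).mk (ψ j) x :=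
    hψd.and (ae_all_iff.2 fun i => (hψ i).ae_eq_mk)
  set N : Set X := toMeasurable μ
    {x | (∀ δ : ℝ, 0 < δ → ∃ j, ψ j x < δ) ∧ ∀ j, ψ j x = (hψ j).mk (ψ j) x}ᶜ with hN
  have hN0 : μ N = 0 := by rw [hN, measure_toMeasurable]; exact hgood
  have hNm : MeasurableSet N := measurableSet_toMeasurable _ _
  have hNc : ∀ x ∉ N, (∀ δ : ℝ, 0 < δ → ∃ j, ψ j x < δ) ∧ ∀ j, ψ j x = (hψ j).mk (ψ j) x := by
    intro x hx
    by_contra h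
    exact hx (subset_toMeasurable _ _ h)
  have hp : ∀ x, ∃ k, x ∈ N ∨ (hψ k).mk (ψ k) x < η / 4 := by
    intro x
    by_cases hx : x ∈ N
    · exact ⟨0, Or.inl hx⟩
    · obtain ⟨k, hk⟩ := (hNc x hx).1 (η / 4) (by positivity)
      exact ⟨k, Or.inr ((hNc x hx).2 k ▸ hk)⟩
  have hfind : Measurable fun x => Nat.find (hp x) :=
    measurable_find hp fun k =>
      hNm.union (measurableSet_lt (hψ k).measurable_mk measurable_const)
  -- Points whose first `η / 4`-close centre has index at least `m`. These sets decrease to `∅`, so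
  -- they can be assigned to centre `0` at small cost in `L¹`.
  set A : ℕ → Set X := fun m => {x | m ≤ Nat.find (hp x)} with hA
  have hAm : ∀ m, MeasurableSet (A m) := fun m => measurableSet_le measurable_const hfind
  have hAlim := tendsto_setIntegral_of_antitone (f := ψ 0) (μ := μ) hAm
    (fun m n hmn x hx => le_trans hmn hx) ⟨0, hψ₀.integrableOn⟩
  have hAe : ⋂ m, A m = ∅ := by
    refine Set.eq_empty_of_forall_notMem fun x hx => ?_
    have : Nat.find (hp x) + 1 ≤ Nat.find (hp x) := Set.mem_iInter.1 hx (Nat.find (hp x) + 1)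
    omega
  rw [hAe, setIntegral_empty] at hAlim
  obtain ⟨m, hm⟩ := (hAlim.eventually_lt_const (show (0 : ℝ) < η / 4 by positivity)).exists
  set c : X → ℕ := fun x => if m ≤ Nat.find (hp x) then 0 else Nat.find (hp x) with hc
  have hcm : Measurable c := Measurable.ite (hAm m) measurable_const hfind
  set M : ℝ := 1 + ∑ i ∈ Finset.range (m + 1), ∑ j ∈ Finset.range (m + 1), |R i j| with hM
  have hM0 : 0 < M := by positivity
  have hcle : ∀ x, c x ∈ Finset.range (m + 1) := by
    intro x
    rw [Finset.mem_range]
    simp only [hc]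
    split_ifs <;> omega
  have hRM : ∀ x y, R (c x) (c y) ≤ M := by
    intro x y
    have h₁ : |R (c x) (c y)| ≤ ∑ j ∈ Finset.range (m + 1), |R (c x) j| :=
      Finset.single_le_sum (f := fun j => |R (c x) j|) (fun _ _ => abs_nonneg _) (hcle y)
    have h₂ := Finset.single_le_sum
      (f := fun i => ∑ j ∈ Finset.range (m + 1), |R i j|)
      (fun _ _ => Finset.sum_nonneg fun _ _ => abs_nonneg _) (hcle x)
    have h₃ := le_abs_self (R (c x) (c y))
    linarith
  obtain ⟨B, hBm, hBμ, I, r, hr, hI⟩ := exists_finset_separating hφ hS hsep hcm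
    (η := ENNReal.ofReal (η / (4 * M))) (by
      rw [ne_eq, ENNReal.ofReal_eq_zero, not_le]; positivity)
  have hBμ' : M * μ.real B < η / 4 := by
    have h : μ.real B < η / (4 * M) := ENNReal.toReal_lt_of_lt_ofReal hBμ
    rw [lt_div_iff₀ (by positivity)] at h
    linarith
  have hi₁ : Integrable ((A m).indicator (ψ 0)) μ := hψ₀.indicator (hAm m)
  have hi₂ : Integrable (B.indicator fun _ => M) μ := (integrable_const M).indicator hBm
  have hn₁ : ∀ x, 0 ≤ (A m).indicator (ψ 0) x :=
    fun x => Set.indicator_nonneg (fun x _ => hψnn 0 x) x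
  have hn₂ : ∀ x, 0 ≤ B.indicator (fun _ => M) x :=
    fun x => Set.indicator_nonneg (fun _ _ => hM0.le) x
  -- The three terms of the error pay for the distance to a centre, the tail `A m` and the bad set
  -- `B`; each has integral at most `η / 4`.
  refine ⟨I, M / r, fun x => η / 4 + (A m).indicator (ψ 0) x + B.indicator (fun _ => M) x,
    by positivity, ((integrable_const _).add hi₁).add hi₂, fun x => ?_, ?_, Nᶜ, ?_, ?_⟩
  · have := hn₁ x
    have := hn₂ x
    positivity
  · have e₁ := integral_add ((integrable_const (η / 4)).add hi₁) hi₂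
    have e₂ := integral_add (μ := μ) (integrable_const (η / 4)) hi₁
    rw [integral_indicator hBm] at e₁
    rw [integral_indicator (hAm m)] at e₂
    simp only [Pi.add_apply, integral_const, measureReal_restrict_apply_univ, probReal_univ,
      smul_eq_mul] at e₁ e₂
    rw [e₁, e₂]
    linarith
  · rw [ae_iff]
    simpa using hN0
  · have hcψ : ∀ x ∉ N, ψ (c x) x ≤ η / 4 + (A m).indicator (ψ 0) x := by
      intro x hx
      by_cases hxm : m ≤ Nat.find (hp x)
      · have : x ∈ A m := hxm
        simp only [hc, if_pos hxm, Set.indicator_of_mem this]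
        linarith
      · have h := (Nat.find_spec (hp x)).resolve_left hx
        rw [← (hNc x hx).2] at h
        simp only [hc, if_neg hxm]
        linarith [hn₁ x]
    intro x hx y hy
    have hsum : 0 ≤ M / r * ∑ i ∈ I, |φ i x - φ i y| := by positivity
    have hRb : R (c x) (c y) ≤ M / r * ∑ i ∈ I, |φ i x - φ i y| +
        (B.indicator (fun _ => M) x + B.indicator (fun _ => M) y) := by
      have hx₂ := hn₂ x
      have hy₂ := hn₂ y
      -- Equal labels cost nothing; a point of `B` pays `M`; otherwise the separating sum is at
      -- least `r`, and the factor `M / r` turns it into `M`.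
      by_cases hxy : c x = c y
      · rw [hxy, hR]
        linarith
      · by_cases hxB : x ∈ B
        · rw [Set.indicator_of_mem hxB]
          linarith [hRM x y]
        by_cases hyB : y ∈ B
        · rw [Set.indicator_of_mem hyB]
          linarith [hRM x y]
        have h : M / r * r ≤ M / r * ∑ i ∈ I, |φ i x - φ i y| :=
          mul_le_mul_of_nonneg_left (hI x hxB y hyB hxy) (by positivity)
        rw [div_mul_cancel₀ _ hr.ne'] at h
        linarith [hRM x y]
    have := hd x y (c x) (c y)
    linarith [hcψ x hx, hcψ y hy]

/-! ### Powers of the automorphism and translated windows -/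

theorem measurePreserving_zpow {X : Type*} [MeasurableSpace X] {μ : Measure X} {T : X ≃ᵐ X}
    (hT : MeasurePreserving T μ μ) (k : ℤ) :
    MeasurePreserving (⇑((T.toEquiv : Equiv.Perm X) ^ k)) μ μ := by
  induction k using Int.induction_on with
  | zero => simpa using MeasurePreserving.id μ
  | succ k ih =>
    rw [zpow_add_one]
    exact ih.comp hT
  | pred k ih =>
    rw [zpow_sub_one]
    exact ih.comp (hT.symm T)

/-- The points of the translate `[k, k + n)` of `[0, n)` which do not lie in `[0, n)`. -/
noncomputable def translateBoundary (k : ℤ) (n : ℕ) : Finset ℤ := Finset.Ico k (k + n) \ Finset.Ico 0 (n : ℤ)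

/-- A translate sticks out of the window on one side only, by at most `|k|` points. The bound does
not depend on `n`, so it disappears after division by `n`. -/
theorem card_translateBoundary_le (k : ℤ) (n : ℕ) : (translateBoundary k n).card ≤ k.natAbs := by
  have h : translateBoundary k n ⊆ Finset.Ico k 0 ∪ Finset.Ico (n : ℤ) (k + n) := by
    intro s hs
    simp only [translateBoundary, Finset.mem_sdiff, Finset.mem_Ico, Finset.mem_union] at hs ⊢
    omega
  refine (Finset.card_le_card h).trans ((Finset.card_union_le _ _).trans ?_)
  rw [Int.card_Ico, Int.card_Ico]
  omega

theorem sum_range_translate_le {a : ℤ → ℝ} (ha : ∀ s, 0 ≤ a s) (k : ℤ) (n : ℕ) :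
    ∑ j ∈ Finset.range n, a (k + j) ≤
      ∑ j ∈ Finset.range n, a j + ∑ s ∈ translateBoundary k n, a s := by
  have h : ∀ k : ℤ, ∑ j ∈ Finset.range n, a (k + j) = ∑ s ∈ Finset.Ico k (k + n), a s := by
    intro k
    refine Finset.sum_nbij' (fun j => k + j) (fun s => (s - k).toNat) ?_ ?_ ?_ ?_ ?_
    · intro j hj
      simp only [Finset.mem_range, Finset.mem_Ico] at hj ⊢
      omega
    · intro s hs
      simp only [Finset.mem_range, Finset.mem_Ico] at hs ⊢
      omega
    · intro j _
      simp
    · intro s hs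
      simp only [Finset.mem_Ico] at hs
      omega
    · intro j _
      rfl
  have h₀ : ∑ j ∈ Finset.range n, a j = ∑ s ∈ Finset.Ico 0 (n : ℤ), a s := by
    simpa using h 0
  rw [h, h₀, translateBoundary, ← Finset.sum_union Finset.disjoint_sdiff]
  refine Finset.sum_le_sum_of_subset_of_nonneg ?_ fun s _ _ => ha s
  rw [Finset.union_sdiff_self_eq_union]
  exact Finset.subset_union_right

/-- Almost every orbit avoids the null set where equivariance fails, so induction along the orbit
applies. -/
theorem ae_semiconj_zpow {X₁ X₂ : Type*} [MeasurableSpace X₁] [MeasurableSpace X₂]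
    {μ₁ : Measure X₁} {T₁ : X₁ ≃ᵐ X₁} {T₂ : X₂ ≃ᵐ X₂} (hT₁ : MeasurePreserving T₁ μ₁ μ₁)
    {π : X₁ → X₂} (hπT : ∀ᵐ x ∂μ₁, π (T₁ x) = T₂ (π x)) :
    ∀ᵐ x ∂μ₁, ∀ j : ℕ, π (((T₁.toEquiv : Equiv.Perm X₁) ^ (j : ℤ)) x) =
      ((T₂.toEquiv : Equiv.Perm X₂) ^ (j : ℤ)) (π x) := by
  have h : ∀ᵐ x ∂μ₁, ∀ k : ℤ, π (T₁ (((T₁.toEquiv : Equiv.Perm X₁) ^ k) x)) =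
      T₂ (π (((T₁.toEquiv : Equiv.Perm X₁) ^ k) x)) :=
    ae_all_iff.2 fun k => (measurePreserving_zpow hT₁ k).quasiMeasurePreserving.ae hπT
  filter_upwards [h] with x hx j
  induction j with
  | zero => simp
  | succ j ih =>
    have h₁ := hx j
    rw [ih] at h₁
    rw [Nat.cast_add, Nat.cast_one, add_comm, zpow_add, zpow_add, zpow_one, zpow_one]
    exact h₁

/-! ### Bounding the semimetric of the factor by shifts -/

/-- A summable admissible semimetric on a factor is bounded by finitely many shifts of a generating
semimetric, up to an error which is small in `L¹`. -/
theorem exists_le_sum_shift_add {X₁ X₂ : Type*} [MeasurableSpace X₁] [StandardBorelSpace X₁]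
    [MeasurableSpace X₂] {μ₁ : Measure X₁} [IsProbabilityMeasure μ₁] {μ₂ : Measure X₂}
    [IsProbabilityMeasure μ₂] {T₁ : X₁ ≃ᵐ X₁} (hT₁ : MeasurePreserving T₁ μ₁ μ₁)
    {π : X₁ → X₂} (hπ : MeasurePreserving π μ₁ μ₂)
    {ρ₁ : X₁ → X₁ → ℝ} (hρ₁ : IsAdmissible μ₁ ρ₁) (hs₁ : IsSummable μ₁ ρ₁)
    (hg₁ : IsGenerating μ₁ T₁ ρ₁)
    {ρ₂ : X₂ → X₂ → ℝ} (hρ₂ : IsAdmissible μ₂ ρ₂) (hs₂ : IsSummable μ₂ ρ₂)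
    {η : ℝ} (hη : 0 < η) :
    ∃ (I : Finset (ℤ × ℕ)) (C : ℝ) (f : X₁ → ℝ), 0 ≤ C ∧ Integrable f μ₁ ∧ (∀ x, 0 ≤ f x) ∧
      ∫ x, f x ∂μ₁ < η ∧ ∃ Z : Set X₁, (∀ᵐ x ∂μ₁, x ∈ Z) ∧ ∀ x ∈ Z, ∀ y ∈ Z,
        ρ₂ (π x) (π y) ≤ C * ∑ i ∈ I, shift T₁ i.1 ρ₁ x y + (f x + f y) := by
  have hsm₁ := hρ₁.isMeasurableSemimetric.isSemimetric
  have hsm₂ := hρ₂.isMeasurableSemimetric.isSemimetric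
  obtain ⟨e, he, hed⟩ := hρ₁.exists_integrable_dense_seq hs₁
  obtain ⟨u, hu, hud⟩ := hρ₂.exists_integrable_dense_seq hs₂
  obtain ⟨X', -, hX', hX'g⟩ := hg₁
  set p : ℤ → X₁ → X₁ := fun k => ⇑((T₁.toEquiv : Equiv.Perm X₁) ^ k) with hp
  have hpm : ∀ k, MeasurePreserving (p k) μ₁ μ₁ := measurePreserving_zpow hT₁
  set φ : ℤ × ℕ → X₁ → ℝ := fun i x => ρ₁ (p i.1 x) (e i.2) with hφ
  set S : Set X₁ := {x | x ∈ X' ∧ ∀ k : ℤ, ∀ δ : ℝ, 0 < δ → ∃ j, ρ₁ (p k x) (e j) < δ} with hS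
  have hSae : ∀ᵐ x ∂μ₁, x ∈ S := by
    have h₁ : ∀ᵐ x ∂μ₁, x ∈ X' := by rw [ae_iff]; exact hX'
    exact h₁.and (ae_all_iff.2 fun k => (hpm k).quasiMeasurePreserving.ae hed)
  have hsep : ∀ x ∈ S, ∀ y ∈ S, (∀ i, φ i x = φ i y) → x = y := by
    intro x hx y hy hxy
    by_contra hne
    obtain ⟨k, hk⟩ := hX'g x hx.1 y hy.1 hne
    -- Both shifted points are equally far from `e j`, so a centre closer than half their distance
    -- contradicts the triangle inequality.
    obtain ⟨j, hj⟩ := hx.2 k (shift T₁ k ρ₁ x y / 2) (by positivity)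
    have h₁ := hsm₁.triangle (p k x) (e j) (p k y)
    have h₂ := hxy (k, j)
    rw [hsm₁.symm (e j)] at h₁
    simp only [hφ] at h₂
    rw [← h₂] at h₁
    have h₃ : shift T₁ k ρ₁ x y = ρ₁ (p k x) (p k y) := rfl
    linarith
  obtain ⟨I, C, f, hC, hfi, hf0, hfη, Z, hZ, hZd⟩ := exists_le_sum_abs_sub_add (φ := φ)
    (fun i => ((hpm i.1).integrable_comp_of_integrable (he i.2)).aemeasurable) hSae hsep
    (d := fun x y => ρ₂ (π x) (π y)) (ψ := fun j x => ρ₂ (π x) (u j))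
    (R := fun i j => ρ₂ (u i) (u j))
    (fun j => (hπ.integrable_comp_of_integrable (hu j)).aemeasurable)
    (hπ.integrable_comp_of_integrable (hu 0)) (fun j x => hsm₂.nonneg _ _)
    (hπ.quasiMeasurePreserving.ae hud) (fun j => hsm₂.self_eq_zero _)
    (fun x y i j => by
      have h₁ := hsm₂.triangle (π x) (u i) (π y)
      have h₂ := hsm₂.triangle (u i) (u j) (π y)
      rw [hsm₂.symm (u j)] at h₂
      linarith) hη
  refine ⟨I, C, f, hC, hfi, hf0, hfη, Z, hZ, fun x hx y hy => (hZd x hx y hy).trans ?_⟩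
  -- The reverse triangle inequality replaces differences of distances to `e i.2` by the shifted
  -- semimetric.
  gcongr with i
  have t₁ := hsm₁.triangle (p i.1 x) (p i.1 y) (e i.2)
  have t₂ := hsm₁.triangle (p i.1 y) (p i.1 x) (e i.2)
  rw [hsm₁.symm (p i.1 y) (p i.1 x)] at t₂
  have h₃ : shift T₁ i.1 ρ₁ x y = ρ₁ (p i.1 x) (p i.1 y) := rfl
  rw [h₃, abs_le]
  simp only [hφ]
  constructor <;> linarith

/-! ### Averaging the bound -/

/-- The average of `f` over `n` shifts, plus `C / n` times the boundary terms of `g` which arise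
from the shifts by the integers `i.1`, `i ∈ I`. -/
noncomputable def errorAverage {X : Type*} [MeasurableSpace X] (T : X ≃ᵐ X) (f g : X → ℝ) (C : ℝ)
    (I : Finset (ℤ × ℕ)) (n : ℕ) (x : X) : ℝ :=
  1 / (n : ℝ) * (∑ j ∈ Finset.range n, f (((T.toEquiv : Equiv.Perm X) ^ (j : ℤ)) x) +
    C * ∑ i ∈ I, ∑ s ∈ translateBoundary i.1 n, g (((T.toEquiv : Equiv.Perm X) ^ s) x))

theorem errorAverage_nonneg {X : Type*} [MeasurableSpace X] (T : X ≃ᵐ X) {f g : X → ℝ} {C : ℝ}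
    (I : Finset (ℤ × ℕ)) (hf : ∀ x, 0 ≤ f x) (hg : ∀ x, 0 ≤ g x) (hC : 0 ≤ C) (n : ℕ) (x : X) :
    0 ≤ errorAverage T f g C I n x := by
  have h₁ : 0 ≤ ∑ j ∈ Finset.range n, f (((T.toEquiv : Equiv.Perm X) ^ (j : ℤ)) x) :=
    Finset.sum_nonneg fun j _ => hf _
  have h₂ : 0 ≤ ∑ i ∈ I, ∑ s ∈ translateBoundary i.1 n, g (((T.toEquiv : Equiv.Perm X) ^ s) x) :=
    Finset.sum_nonneg fun i _ => Finset.sum_nonneg fun s _ => hg _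
  unfold errorAverage
  positivity

theorem integrable_errorAverage {X : Type*} [MeasurableSpace X] {μ : Measure X} {T : X ≃ᵐ X}
    (hT : MeasurePreserving T μ μ) {f g : X → ℝ} (hf : Integrable f μ) (hg : Integrable g μ)
    (C : ℝ) (I : Finset (ℤ × ℕ)) (n : ℕ) : Integrable (errorAverage T f g C I n) μ := by
  refine Integrable.const_mul (Integrable.add ?_ (Integrable.const_mul ?_ _)) _
  · exact integrable_finsetSum _ fun j _ =>
      (measurePreserving_zpow hT j).integrable_comp_of_integrable hf
  · exact integrable_finsetSum _ fun i _ => integrable_finsetSum _ fun s _ =>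
      (measurePreserving_zpow hT s).integrable_comp_of_integrable hg

/-- Invariance gives every shifted term the same integral, and the number of boundary terms is
bounded uniformly in `n`. -/
theorem integral_errorAverage_le {X : Type*} [MeasurableSpace X] [StandardBorelSpace X]
    {μ : Measure X} {T : X ≃ᵐ X} (hT : MeasurePreserving T μ μ) {f g : X → ℝ}
    (hf : Integrable f μ) (hg : Integrable g μ) (hg0 : ∀ x, 0 ≤ g x) {C : ℝ} (hC : 0 ≤ C)
    (I : Finset (ℤ × ℕ)) {n : ℕ} (hn : n ≠ 0) :
    ∫ x, errorAverage T f g C I n x ∂μ ≤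
      ∫ x, f x ∂μ + C * (∑ i ∈ I, (i.1.natAbs : ℝ) * ∫ x, g x ∂μ) / n := by
  have hn' : (n : ℝ) ≠ 0 := Nat.cast_ne_zero.2 hn
  have hgI : 0 ≤ ∫ x, g x ∂μ := integral_nonneg hg0
  have hp : ∀ (F : X → ℝ), Integrable F μ → ∀ k : ℤ,
      Integrable (fun x => F (((T.toEquiv : Equiv.Perm X) ^ k) x)) μ :=
    fun F hF k => (measurePreserving_zpow hT k).integrable_comp_of_integrable hF
  have hint : ∀ (F : X → ℝ) (k : ℤ),
      ∫ x, F (((T.toEquiv : Equiv.Perm X) ^ k) x) ∂μ = ∫ x, F x ∂μ :=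
    fun F k => (measurePreserving_zpow hT k).integral_comp
      ((measurePreserving_zpow hT k).measurable.measurableEmbedding (Equiv.injective _)) F
  have e₁ : ∫ x, ∑ j ∈ Finset.range n, f (((T.toEquiv : Equiv.Perm X) ^ (j : ℤ)) x) ∂μ =
      n * ∫ x, f x ∂μ := by
    rw [integral_finsetSum _ fun (j : ℕ) _ => hp f hf j]
    simp only [hint, Finset.sum_const, nsmul_eq_mul, Finset.card_range]
  have e₂ : ∫ x, ∑ i ∈ I, ∑ s ∈ translateBoundary i.1 n,
      g (((T.toEquiv : Equiv.Perm X) ^ s) x) ∂μ ≤ ∑ i ∈ I, (i.1.natAbs : ℝ) * ∫ x, g x ∂μ := by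
    rw [integral_finsetSum _ fun i _ => integrable_finsetSum _ fun s _ => hp g hg s]
    refine Finset.sum_le_sum fun i _ => ?_
    rw [integral_finsetSum _ fun s _ => hp g hg s]
    simp only [hint, Finset.sum_const, nsmul_eq_mul]
    exact mul_le_mul_of_nonneg_right (by exact_mod_cast card_translateBoundary_le i.1 n) hgI
  have e₃ := mul_le_mul_of_nonneg_left e₂ hC
  unfold errorAverage
  rw [integral_const_mul, integral_add
    (integrable_finsetSum _ fun j _ => hp f hf _)
    ((integrable_finsetSum _ fun i _ => integrable_finsetSum _ fun s _ => hp g hg s).const_mul C),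
    integral_const_mul, e₁, one_div_mul_eq_div, div_le_iff₀ (by positivity)]
  rw [add_mul, div_mul_cancel₀ _ hn']
  linarith

/-- The bound of a semimetric by finitely many shifts passes to averages. -/
theorem average_le_errorAverage {X₁ X₂ : Type*} [MeasurableSpace X₁] [MeasurableSpace X₂]
    {T₁ : X₁ ≃ᵐ X₁} {T₂ : X₂ ≃ᵐ X₂} {π : X₁ → X₂} {ρ₁ : X₁ → X₁ → ℝ} (hρ₁ : IsSemimetric ρ₁)
    {ρ₂ : X₂ → X₂ → ℝ} {I : Finset (ℤ × ℕ)} {C : ℝ} {f : X₁ → ℝ} (hC : 0 ≤ C) {Z : Set X₁}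
    (hZ : ∀ x ∈ Z, ∀ y ∈ Z,
      ρ₂ (π x) (π y) ≤ C * ∑ i ∈ I, shift T₁ i.1 ρ₁ x y + (f x + f y)) (z : X₁) (n : ℕ)
    {x y : X₁} (hx : ∀ k : ℤ, ((T₁.toEquiv : Equiv.Perm X₁) ^ k) x ∈ Z)
    (hy : ∀ k : ℤ, ((T₁.toEquiv : Equiv.Perm X₁) ^ k) y ∈ Z)
    (hxπ : ∀ j : ℕ, π (((T₁.toEquiv : Equiv.Perm X₁) ^ (j : ℤ)) x) =
      ((T₂.toEquiv : Equiv.Perm X₂) ^ (j : ℤ)) (π x))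
    (hyπ : ∀ j : ℕ, π (((T₁.toEquiv : Equiv.Perm X₁) ^ (j : ℤ)) y) =
      ((T₂.toEquiv : Equiv.Perm X₂) ^ (j : ℤ)) (π y)) :
    average T₂ n ρ₂ (π x) (π y) ≤ C * I.card * average T₁ n ρ₁ x y +
      (errorAverage T₁ f (fun w => ρ₁ w z) C I n x +
        errorAverage T₁ f (fun w => ρ₁ w z) C I n y) := by
  set p : ℤ → X₁ → X₁ := fun k => ⇑((T₁.toEquiv : Equiv.Perm X₁) ^ k) with hp
  set g : X₁ → ℝ := fun w => ρ₁ w z with hg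
  set a : ℤ → ℝ := fun s => shift T₁ s ρ₁ x y with ha
  have ha0 : ∀ s, 0 ≤ a s := fun s => hρ₁.nonneg _ _
  -- Passing through `z` splits a boundary term into functions of one point, to which Markov's
  -- inequality can be applied later.
  have hag : ∀ s, a s ≤ g (p s x) + g (p s y) := by
    intro s
    have := hρ₁.triangle (p s x) z (p s y)
    rwa [hρ₁.symm z] at this
  have hstep : ∀ j : ℕ, shift T₂ j ρ₂ (π x) (π y) ≤
      C * ∑ i ∈ I, a (i.1 + j) + (f (p j x) + f (p j y)) := by
    intro j
    have h₁ := hZ _ (hx j) _ (hy j)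
    rw [hxπ, hyπ] at h₁
    refine h₁.trans_eq ?_
    simp only [ha, hp, shift, zpow_add, Equiv.Perm.mul_apply]
  have hcomm : ∑ j ∈ Finset.range n, ∑ i ∈ I, a (i.1 + j) ≤
      I.card * ∑ j ∈ Finset.range n, a j +
        (∑ i ∈ I, ∑ s ∈ translateBoundary i.1 n, g (p s x) +
          ∑ i ∈ I, ∑ s ∈ translateBoundary i.1 n, g (p s y)) := by
    rw [Finset.sum_comm, ← nsmul_eq_mul, ← Finset.sum_const, ← Finset.sum_add_distrib,
      ← Finset.sum_add_distrib]
    refine Finset.sum_le_sum fun i _ => ?_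
    refine (sum_range_translate_le ha0 i.1 n).trans ?_
    rw [← Finset.sum_add_distrib]
    gcongr with s
    exact hag s
  have h₁ : ∑ j ∈ Finset.range n, shift T₂ j ρ₂ (π x) (π y) ≤
      C * ∑ j ∈ Finset.range n, ∑ i ∈ I, a (i.1 + j) +
        (∑ j ∈ Finset.range n, f (p j x) + ∑ j ∈ Finset.range n, f (p j y)) := by
    rw [Finset.mul_sum, ← Finset.sum_add_distrib, ← Finset.sum_add_distrib]
    exact Finset.sum_le_sum fun j _ => hstep j
  have h₂ := mul_le_mul_of_nonneg_left hcomm hC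
  have h₃ := h₁.trans (add_le_add_left h₂ _)
  have h₄ := mul_le_mul_of_nonneg_left h₃ (show 0 ≤ 1 / (n : ℝ) by positivity)
  refine h₄.trans_eq ?_
  simp only [average, errorAverage]
  ring

/-- For a generating semimetric `ρ₁` on a system and a summable admissible semimetric `ρ₂` on a
factor, closeness in the averages of `ρ₁` implies closeness of the images in the averages of `ρ₂`,
outside a set of small measure. -/
theorem exists_average_le {X₁ X₂ : Type*} [MeasurableSpace X₁] [StandardBorelSpace X₁]
    [MeasurableSpace X₂] {μ₁ : Measure X₁} [IsProbabilityMeasure μ₁] {μ₂ : Measure X₂}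
    [IsProbabilityMeasure μ₂] {T₁ : X₁ ≃ᵐ X₁} {T₂ : X₂ ≃ᵐ X₂} (hT₁ : MeasurePreserving T₁ μ₁ μ₁)
    {π : X₁ → X₂} (hπ : MeasurePreserving π μ₁ μ₂) (hπT : ∀ᵐ x ∂μ₁, π (T₁ x) = T₂ (π x))
    {ρ₁ : X₁ → X₁ → ℝ} (hρ₁ : IsAdmissible μ₁ ρ₁) (hs₁ : IsSummable μ₁ ρ₁)
    (hg₁ : IsGenerating μ₁ T₁ ρ₁)
    {ρ₂ : X₂ → X₂ → ℝ} (hρ₂ : IsAdmissible μ₂ ρ₂) (hs₂ : IsSummable μ₂ ρ₂)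
    {ε : ℝ} (hε : 0 < ε) :
    ∃ δ : ℝ, 0 < δ ∧ ∀ᶠ n in atTop, ∃ G : Set X₁, MeasurableSet G ∧
      μ₁ Gᶜ < ENNReal.ofReal (ε / 2) ∧ ∀ x ∈ G, ∀ y ∈ G, average T₁ n ρ₁ x y < δ →
        average T₂ n ρ₂ (π x) (π y) ≤ ε / 2 := by
  have hsm₁ := hρ₁.isMeasurableSemimetric.isSemimetric
  obtain ⟨e, he, -⟩ := hρ₁.exists_integrable_dense_seq hs₁
  obtain ⟨I, C, f, hC, hfi, hf0, hfη, Z, hZ, hZd⟩ := exists_le_sum_shift_add hT₁ hπ hρ₁ hs₁ hg₁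
    -- The errors from `f` and from the boundary total less than `ε ^ 2 / 16 = (ε / 8) * (ε / 2)`:
    -- Markov at level `ε / 8` leaves a bad set of measure below `ε / 2`.
    hρ₂ hs₂ (show (0 : ℝ) < ε ^ 2 / 32 by positivity)
  have hg0 : ∀ x, 0 ≤ ρ₁ x (e 0) := fun x => hsm₁.nonneg _ _
  set F : ℕ → X₁ → ℝ := errorAverage T₁ f (fun w => ρ₁ w (e 0)) C I with hF
  have hF0 : ∀ n x, 0 ≤ F n x := errorAverage_nonneg T₁ I hf0 hg0 hC
  have hFi : ∀ n, Integrable (F n) μ₁ := integrable_errorAverage hT₁ hfi (he 0) C I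
  set c : ℝ := C * I.card with hc
  have hc0 : 0 ≤ c := by positivity
  -- The main term is then at most `ε / 4`, and the two point errors add less than `ε / 4`. The `+
  -- 1` covers `c = 0`.
  refine ⟨ε / (4 * (c + 1)), by positivity, ?_⟩
  filter_upwards [(tendsto_const_div_atTop_nhds_zero_nat (C * (∑ i ∈ I, (i.1.natAbs : ℝ) *
    ∫ x, ρ₁ x (e 0) ∂μ₁))).eventually_lt_const (show (0 : ℝ) < ε ^ 2 / 32 by positivity),
    eventually_ne_atTop 0] with n hn hn0
  set W : Set X₁ := {x | (∀ k : ℤ, ((T₁.toEquiv : Equiv.Perm X₁) ^ k) x ∈ Z) ∧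
    ∀ j : ℕ, π (((T₁.toEquiv : Equiv.Perm X₁) ^ (j : ℤ)) x) =
      ((T₂.toEquiv : Equiv.Perm X₂) ^ (j : ℤ)) (π x)} with hW
  have hWae : ∀ᵐ x ∂μ₁, x ∈ W :=
    (ae_all_iff.2 fun k => (measurePreserving_zpow hT₁ k).quasiMeasurePreserving.ae hZ).and
      (ae_semiconj_zpow hT₁ hπT)
  have hbad : μ₁ {x | x ∈ W ∧ F n x < ε / 8}ᶜ < ENNReal.ofReal (ε / 2) := by
    have h₁ : μ₁ {x | x ∈ W ∧ F n x < ε / 8}ᶜ ≤ μ₁ {x | ε / 8 ≤ F n x} := by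
      refine measure_mono_ae ?_
      filter_upwards [hWae] with x hx hx'
      by_contra h
      exact hx' ⟨hx, not_le.1 h⟩
    have h₂ := mul_meas_ge_le_integral_of_nonneg (ae_of_all _ (hF0 n)) (hFi n) (ε / 8)
    have h₃ := integral_errorAverage_le hT₁ hfi (he 0) hg0 hC I hn0
    have h₄ : μ₁.real {x | ε / 8 ≤ F n x} < ε / 2 := by
      have : ε / 8 * μ₁.real {x | ε / 8 ≤ F n x} < ε / 8 * (ε / 2) := by
        have : ε / 8 * (ε / 2) = ε ^ 2 / 32 + ε ^ 2 / 32 := by ring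
        linarith
      exact lt_of_mul_lt_mul_left this (by positivity)
    refine h₁.trans_lt ?_
    rw [← ofReal_measureReal]
    exact (ENNReal.ofReal_lt_ofReal_iff (by positivity)).2 h₄
  refine ⟨(toMeasurable μ₁ {x | x ∈ W ∧ F n x < ε / 8}ᶜ)ᶜ,
    (measurableSet_toMeasurable _ _).compl, by rwa [compl_compl, measure_toMeasurable], ?_⟩
  have hmem : ∀ x ∈ (toMeasurable μ₁ {x | x ∈ W ∧ F n x < ε / 8}ᶜ)ᶜ, x ∈ W ∧ F n x < ε / 8 := by
    intro x hx
    by_contra h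
    exact hx (subset_toMeasurable _ _ h)
  intro x hx y hy hxy
  obtain ⟨hxW, hxF⟩ := hmem x hx
  obtain ⟨hyW, hyF⟩ := hmem y hy
  have htot := average_le_errorAverage hsm₁ hC hZd (e 0) n hxW.1 hyW.1 hxW.2 hyW.2
  have hcδ : c * average T₁ n ρ₁ x y ≤ ε / 4 := by
    refine (mul_le_mul_of_nonneg_left hxy.le hc0).trans ?_
    rw [mul_div_assoc', div_le_div_iff₀ (by positivity) (by positivity)]
    nlinarith
  linarith

/-! ### Transferring partitions and entropy to the factor -/

/-- The image of a measurable set contains a measurable set whose preimage covers all but a small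
part of the original set. -/
theorem exists_measurableSet_subset_image {X₁ X₂ : Type*} [MeasurableSpace X₁]
    [StandardBorelSpace X₁] [MeasurableSpace X₂] [StandardBorelSpace X₂] (μ : Measure X₁)
    [IsFiniteMeasure μ] {π : X₁ → X₂} (hπ : Measurable π) {E : Set X₁} (hE : MeasurableSet E)
    {ξ : ℝ≥0∞} (hξ : ξ ≠ 0) :
    ∃ Q : Set X₂, MeasurableSet Q ∧ Q ⊆ π '' E ∧ μ (E \ π ⁻¹' Q) < ξ := by
  let := upgradeStandardBorel X₁
  let := upgradeStandardBorel X₂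
  have hΓ : Measurable fun x => (x, π x) := measurable_id.prodMk hπ
  -- The image of `E` is in general only analytic, so a compact part of the graph over `E` is
  -- projected instead.
  have hH : MeasurableSet {p : X₁ × X₂ | p.1 ∈ E ∧ p.2 = π p.1} :=
    (measurable_fst hE).inter (measurableSet_eq_fun measurable_snd (hπ.comp measurable_fst))
  obtain ⟨L, hLH, hLc, hL⟩ := hH.exists_isCompact_sdiff_lt
    (measure_ne_top (μ.map fun x => (x, π x)) _) hξ
  refine ⟨Prod.snd '' L, (hLc.image continuous_snd).measurableSet, ?_, ?_⟩
  · rintro _ ⟨p, hp, rfl⟩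
    exact ⟨p.1, (hLH hp).1, (hLH hp).2.symm⟩
  · rw [Measure.map_apply hΓ (hH.diff hLc.measurableSet)] at hL
    refine (measure_mono ?_).trans_lt hL
    rintro x ⟨hx, hxQ⟩
    exact ⟨⟨hx, rfl⟩, fun h => hxQ ⟨_, h, rfl⟩⟩

theorem lt_of_diameter_lt {X : Type*} {ρ : X → X → ℝ} {A : Set X} {ε : ℝ}
    (h : diameter ρ A < ENNReal.ofReal ε) {x y : X} (hx : x ∈ A) (hy : y ∈ A) : ρ x y < ε := by
  have h₁ : ENNReal.ofReal (ρ x y) ≤ diameter ρ A :=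
    le_iSup₂_of_le x hx (le_iSup₂_of_le y hy le_rfl)
  exact (ENNReal.ofReal_lt_ofReal_iff'.1 (h₁.trans_lt h)).1

/-- Two points in the image of `A j ∩ G` lift to points of the same piece, hence are `σ₂`-close.
These images may overlap or fail to be measurable, so measurable subsets of them are made disjoint
and the remainder goes into the exceptional set. -/
theorem HasPartition.of_factor {X₁ X₂ : Type*} [MeasurableSpace X₁] [StandardBorelSpace X₁]
    [MeasurableSpace X₂] [StandardBorelSpace X₂] {μ₁ : Measure X₁} [IsFiniteMeasure μ₁]
    {μ₂ : Measure X₂} {π : X₁ → X₂} (hπ : MeasurePreserving π μ₁ μ₂)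
    {σ₁ : X₁ → X₁ → ℝ} {σ₂ : X₂ → X₂ → ℝ} {ε δ : ℝ} (hε : 0 < ε) {G : Set X₁}
    (hG : MeasurableSet G) (hGμ : μ₁ Gᶜ < ENNReal.ofReal (ε / 2))
    (hσ : ∀ x ∈ G, ∀ y ∈ G, σ₁ x y < δ → σ₂ (π x) (π y) ≤ ε / 2) (hδ : δ ≤ ε / 2) {k : ℕ}
    (h : HasPartition μ₁ σ₁ δ k) : HasPartition μ₂ σ₂ ε k := by
  obtain ⟨A, hAm, -, hAu, hA0, hAd⟩ := h
  have hs : μ₁ (A 0 ∪ Gᶜ) < ENNReal.ofReal ε := by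
    refine (measure_union_le _ _).trans_lt ?_
    rw [← add_halves ε, ENNReal.ofReal_add (by positivity) (by positivity)]
    exact ENNReal.add_lt_add (hA0.trans_le (ENNReal.ofReal_le_ofReal hδ)) hGμ
  -- The slack between `μ₁ (A 0 ∪ Gᶜ)` and `ε` is shared among the losses incurred in shrinking the
  -- images.
  obtain ⟨ξ, hξ, hξs⟩ := ENNReal.exists_pos_sum_of_countable' (tsub_pos_of_lt hs).ne'
    (Fin (k + 1))
  choose Q hQm hQs hQμ using fun j => exists_measurableSet_subset_image μ₁ hπ.measurable
    ((hAm j).inter hG) (hξ j).ne'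
  -- Index `0` is left empty here because it is reserved for the exceptional set.
  set Q' : Fin (k + 1) → Set X₂ := fun j => if j = 0 then ∅ else Q j with hQ'
  have hQ'm : ∀ j, MeasurableSet (Q' j) := by
    intro j
    simp only [hQ']
    split_ifs
    exacts [MeasurableSet.empty, hQm j]
  have hdm : ∀ j, MeasurableSet (disjointed Q' j) := fun j => by
    rw [disjointed_eq_inter_compl]
    exact (hQ'm j).inter
      (MeasurableSet.iInter fun i => MeasurableSet.iInter fun _ => (hQ'm i).compl)
  refine ⟨fun j => if j = 0 then (⋃ i, Q' i)ᶜ else disjointed Q' j, ?_, ?_, ?_, ?_, ?_⟩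
  · intro j
    simp only
    split_ifs
    exacts [(MeasurableSet.iUnion hQ'm).compl, hdm j]
  · intro i j hij
    have hsub : ∀ j, disjointed Q' j ⊆ ⋃ i, Q' i :=
      fun j => (disjointed_subset Q' j).trans (Set.subset_iUnion Q' j)
    simp only
    split_ifs with hi hj hj
    · exact absurd (hi.trans hj.symm) hij
    · exact disjoint_compl_left.mono_right (hsub j)
    · exact disjoint_compl_right.mono_left (hsub i)
    · exact disjoint_disjointed Q' hij
  · refine Set.eq_univ_of_forall fun z => ?_
    by_cases hz : z ∈ ⋃ i, Q' i
    · rw [← iUnion_disjointed] at hz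
      obtain ⟨j, hj⟩ := Set.mem_iUnion.1 hz
      refine Set.mem_iUnion.2 ⟨j, ?_⟩
      have hj0 : j ≠ 0 := by
        rintro rfl
        have := disjointed_subset Q' 0 hj
        simp [hQ'] at this
      simpa only [if_neg hj0] using hj
    · exact Set.mem_iUnion.2 ⟨0, by simpa using hz⟩
  · simp only [if_true]
    rw [← hπ.measure_preimage (MeasurableSet.iUnion hQ'm).compl.nullMeasurableSet]
    have hsub : π ⁻¹' (⋃ i, Q' i)ᶜ ⊆
        (A 0 ∪ Gᶜ) ∪ ⋃ j, (A j ∩ G) \ π ⁻¹' Q j := by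
      intro x hx
      by_cases hxG : x ∈ G
      · obtain ⟨j, hj⟩ := Set.mem_iUnion.1 (hAu ▸ Set.mem_univ x)
        by_cases hj0 : j = 0
        · exact Or.inl (Or.inl (hj0 ▸ hj))
        · refine Or.inr (Set.mem_iUnion.2 ⟨j, ⟨hj, hxG⟩, fun hxQ => hx ?_⟩)
          refine Set.mem_iUnion.2 ⟨j, ?_⟩
          simp only [hQ', if_neg hj0]
          exact hxQ
      · exact Or.inl (Or.inr hxG)
    calc μ₁ (π ⁻¹' (⋃ i, Q' i)ᶜ)
        ≤ μ₁ (A 0 ∪ Gᶜ) + ∑' j, ξ j :=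
          (measure_mono hsub).trans <| (measure_union_le _ _).trans <| add_le_add le_rfl <|
            (measure_iUnion_le _).trans <| ENNReal.tsum_le_tsum fun j => (hQμ j).le
      _ < μ₁ (A 0 ∪ Gᶜ) + (ENNReal.ofReal ε - μ₁ (A 0 ∪ Gᶜ)) :=
          ENNReal.add_lt_add_left (measure_ne_top _ _) hξs
      _ = ENNReal.ofReal ε := add_tsub_cancel_of_le hs.le
  · intro j hj
    simp only [if_neg hj]
    refine lt_of_le_of_lt ?_
      ((ENNReal.ofReal_lt_ofReal_iff hε).2 (half_lt_self hε))
    refine iSup₂_le fun u hu => iSup₂_le fun v hv => ENNReal.ofReal_le_ofReal ?_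
    have hQj : ∀ w ∈ disjointed Q' j, w ∈ π '' (A j ∩ G) := by
      intro w hw
      have := disjointed_subset Q' j hw
      simp only [hQ', if_neg hj] at this
      exact hQs j this
    obtain ⟨x, hx, rfl⟩ := hQj u hu
    obtain ⟨y, hy, rfl⟩ := hQj v hv
    exact hσ x hx.2 y hy.2 (lt_of_diameter_lt (hAd j hj) hx.1 hy.1)

theorem epsEntropy_le_of_hasPartition {X₁ X₂ : Type*} [MeasurableSpace X₁] [MeasurableSpace X₂]
    {μ₁ : Measure X₁} {μ₂ : Measure X₂} {σ₁ : X₁ → X₁ → ℝ} {σ₂ : X₂ → X₂ → ℝ} {ε δ : ℝ}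
    (h : ∀ k, HasPartition μ₁ σ₁ δ k → HasPartition μ₂ σ₂ ε k) :
    epsEntropy μ₂ σ₂ ε ≤ epsEntropy μ₁ σ₁ δ := by
  by_cases hne : {k : ℕ | 1 ≤ k ∧ HasPartition μ₁ σ₁ δ k}.Nonempty
  · have hsub : {k : ℕ | 1 ≤ k ∧ HasPartition μ₁ σ₁ δ k} ⊆
        {k : ℕ | 1 ≤ k ∧ HasPartition μ₂ σ₂ ε k} := fun k hk => ⟨hk.1, h k hk.2⟩
    rw [epsEntropy, epsEntropy, if_pos hne, if_pos (hne.mono hsub)]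
    refine ENNReal.ofReal_le_ofReal (Real.logb_le_logb_of_le one_lt_two ?_ ?_)
    · exact Nat.cast_pos.2 (Nat.sInf_mem (hne.mono hsub)).1
    · exact Nat.cast_le.2 (Nat.sInf_le (hsub (Nat.sInf_mem hne)))
  · rw [epsEntropy.eq_1 μ₁, if_neg hne]
    exact le_top

end ScalingEntropy

/-! ### Comparison of the scaling sequences -/

open ScalingEntropy in
theorem mainTheorem3
    {X₁ X₂ : Type*}
    [MeasurableSpace X₁] [StandardBorelSpace X₁] [MeasurableSpace X₂] [StandardBorelSpace X₂]
    (μ₁ : MeasureTheory.Measure X₁) [MeasureTheory.IsProbabilityMeasure μ₁]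
    (μ₂ : MeasureTheory.Measure X₂) [MeasureTheory.IsProbabilityMeasure μ₂]
    (T₁ : X₁ ≃ᵐ X₁) (hT₁ : Ergodic T₁ μ₁)
    (T₂ : X₂ ≃ᵐ X₂) (hT₂ : Ergodic T₂ μ₂)
    (hfactor : ScalingEntropy.IsFactor μ₂ T₂ μ₁ T₁)
    (h₁ h₂ : ℕ → ℝ)
    (hh₁ : ScalingEntropy.IsScalingEntropySequence μ₁ T₁ h₁)
    (hh₂ : ScalingEntropy.IsScalingEntropySequence μ₂ T₂ h₂) :
    Asymptotics.IsBigO Filter.atTop h₂ h₁ := by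
  obtain ⟨π, hπ, hπT⟩ := hfactor
  obtain ⟨ρ₁, hρ₁, hs₁, hg₁, hsc₁⟩ := hh₁
  obtain ⟨ρ₂, hρ₂, hs₂, -, hsc₂⟩ := hh₂
  obtain ⟨ε₀, hε₀, hlow⟩ := hsc₂.lower
  have hε : 0 < ε₀ / 2 := by positivity
  obtain ⟨δ, hδ, hG⟩ := exists_average_le hT₁.toMeasurePreserving hπ hπT hρ₁ hs₁ hg₁ hρ₂ hs₂ hε
  -- Capping at half of `ε₀ / 2` leaves room for both `A 0` and the complement of `G` in the new
  -- exceptional set.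
  have hδ' : 0 < min δ (ε₀ / 2 / 2) := lt_min hδ (by positivity)
  obtain ⟨c, hc0, hc⟩ := exists_between (hlow (ε₀ / 2) hε (half_lt_self hε₀))
  obtain ⟨C, hC, hCt⟩ := exists_between (hsc₁.upper _ hδ')
  have hct : c ≠ ⊤ := (hc.trans_le le_top).ne
  have hc' : 0 < c.toReal := ENNReal.toReal_pos hc0.ne' hct
  refine Asymptotics.IsBigO.of_bound (C.toReal / c.toReal) ?_
  filter_upwards [hG, eventually_lt_of_lt_liminf hc, eventually_lt_of_limsup_lt hC,
    eventually_ge_atTop 1] with n ⟨G, hGm, hGμ, hGσ⟩ hlo hup hn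
  have hp₁ := hsc₁.pos n hn
  have hp₂ := hsc₂.pos n hn
  have hent : epsEntropy μ₂ (average T₂ n ρ₂) (ε₀ / 2) ≤
      epsEntropy μ₁ (average T₁ n ρ₁) (min δ (ε₀ / 2 / 2)) :=
    epsEntropy_le_of_hasPartition fun k hk => hk.of_factor hπ hε hGm hGμ
      (fun x hx y hy hxy => hGσ x hx y hy (hxy.trans_le (min_le_left _ _))) (min_le_right _ _)
  -- The chain is `c * h₂ n ≤` entropy of the factor `≤` entropy of the extension `≤ C * h₁ n`.
  have hle : c * ENNReal.ofReal (h₂ n) ≤ C * ENNReal.ofReal (h₁ n) := by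
    refine ((ENNReal.le_div_iff_mul_le ?_ ?_).1 hlo.le).trans
      (hent.trans ((ENNReal.div_le_iff_le_mul ?_ ?_).1 hup.le))
    all_goals first | exact Or.inl ENNReal.ofReal_ne_top | exact Or.inl (by simpa)
  have hle' := ENNReal.toReal_mono (ENNReal.mul_ne_top hCt.ne ENNReal.ofReal_ne_top) hle
  rw [ENNReal.toReal_mul, ENNReal.toReal_mul, ENNReal.toReal_ofReal hp₂.le,
    ENNReal.toReal_ofReal hp₁.le] at hle'
  rw [Real.norm_of_nonneg hp₂.le, Real.norm_of_nonneg hp₁.le, div_mul_eq_mul_div,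
    le_div_iff₀ hc']
  linarith
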